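/- **Conventions.** All graphs are finite. A graph $G$ consists of vertices $V_G$, directed edges $E^{\rm dir}_G$, head and tail maps $h_G,t_G:E^{\rm dir}_G\to V_G$ and an involution $\iota_G$ of $E^{\rm dir}_G$ with $t_G\iota_G=h_G$. Its edges $E_G$ are the orbits of $\iota_G$; a fixed point of $\iota_G$ is a half-loop, and an orbit of size two whose head and tail agree is a whole-loop. The degree of $v$ is the number of directed edges with head $v$. Put $\mathrm{ord}(G)=\#E_G-\#V_G$, and let $\mu_1(G)$ be the Perron–Frobenius eigenvalue (spectral radius) of the non-backtracking matrix $H_G$ indexed by $E^{\rm dir}_G$, where $(H_G)_{e_1,e_2}=1$ if $h_Ge_1=t_Ge_2$ and $\iota_Ge_1\ne e_2$, and $0$ otherwise. Let $B$ be a graph. A coordinatized cover of $B$ of degree $n$ is given by permutations $\sigma(e)$ of $[n]$ $(e\in E_B^{\rm dir})$ with $\sigma(\iota_Be)=\sigma(e)^{-1}$: it has vertices $V_B\times[n]$, directed edges $E_B^{\rm dir}\times[n]$, $t(e,i)=(t_Be,i)$, $h(e,i)=(h_Be,\sigma(e)i)$, $\iota(e,i)=(\iota_Be,\sigma(e)i)$,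 and it is mapped to $B$ by the first projection. A model over $B$ is a family $\{\mathcal C_n(B)\}_{n\in N}$, with $N$ an infinite set of positive integers, of probability spaces whose atoms (of positive probability) are coordinatized covers of $B$ of degree $n$. A $B$-graph (a graph $S$ with a morphism to $B$) occurs in the model if for all sufficiently large $n\in N$ it is isomorphic, over $B$, to a subgraph of some atom of $\mathcal C_n(B)$; it is étale if the morphism is injective on the directed edges with any given head, and on those with any given tail. A graph $S$ occurs if some morphism $S\to B$ makes it a $B$-graph that occurs. The tangle power $\tau_{\rm tang}$ of the model is the smallest order of a connected graph $S$ that occurs in it and satisfies $\mu_1(S)>\mu_1(B)^{1/2}$ ($+\infty$ if there is none). In the *full cycle-involution model* of even (odd) degree, $N$ is the set of even (odd) positive integers, the permutations of different edges are independent, and $\sigma(e)$ is uniform among all permutations if $e$ has distinct endpoints, among the $n$-cycles if $e$ is a whole-loop, and among the involutions with no (with exactly one) fixed point if $e$ is a half-loop. The *permutation-involution model* is the same with $\sigma(e)$ uniform among all permutations also for whole-loops. If $B$ has no half-loops, $N$ may also be the set of all positive integers. These are the *basic models*. **Theorem.** Let $B$ be a graph and let $m'=m'(B)$ be the smallest integer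 with $m'-1>\mu_1(B)^{1/2}$. Let $\{\mathcal C_n(B)\}$ be a model over $B$ (for example, an algebraic model) in which no graph with one or more whole-loops occurs. Then $\tau_{\rm tang}\ge m'-2$. Equality holds if the graph consisting of two vertices joined by $m'$ edges occurs in $\mathcal C_n(B)$. In particular, equality holds if some vertex of $B$ is incident upon at least $m'+1$ self-loops (any combination of whole-loops and half-loops, each whole-loop counted once) and the model is one of the basic models or a model in which every étale $B$-graph without half-loops occurs (as in every strongly algebraic model). In the full cycle-involution models no graph with whole-loops occurs. Hence, if $B$ is non-empty and $d$-regular, $d\ge1$, then $m'(B)=\lfloor (d-1)^{1/2}\rfloor+2$, and for each full cycle-involution model over $B$, of even or of odd degree (or of any degree, if there are no half-loops), $$\tau_{\rm tang}\ \ge\ \bigl\lfloor (d-1)^{1/2}\bigr\rfloor .$$ -/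

import Mathlib

/-- A graph in the sense of coverings: `V` are the vertices, `E` the *directed* edges, and `inv` is
the edge-reversing involution.  Multiple edges and two kinds of self-loops are allowed. -/
structure LoopGraph (V E : Type*) where
  head : E → V
  tail : E → V
  inv : E → E
  inv_inv : ∀ e, inv (inv e) = e
  tail_inv : ∀ e, tail (inv e) = head e

namespace LoopGraph

/-- A half-loop: a directed edge fixed by the involution (it is then automatically a self-loop). -/
def IsHalfLoop {V E : Type*} (G : LoopGraph V E) (e : E) : Prop :=
  G.inv e = e

/-- A whole-loop: a self-loop that is not fixed by the involution. -/
def IsWholeLoop {V E : Type*} (G : LoopGraph V E) (e : E) : Prop :=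
  G.inv e ≠ e ∧ G.head e = G.tail e

/-- The edges: the orbits of the involution. -/
def edgeSet {V E : Type*} (G : LoopGraph V E) : Set (Set E) :=
  {o | ∃ e, o = {e, G.inv e}}

/-- The self-loops (half-loops and whole-loops, as orbits of the involution) incident upon `v`;
a whole-loop is one element of this set. -/
def selfLoopsAt {V E : Type*} (G : LoopGraph V E) (v : V) : Set (Set E) :=
  {o | ∃ e, G.tail e = v ∧ G.head e = v ∧ o = {e, G.inv e}}

/-- The order of a graph: number of edges minus number of vertices. -/
noncomputable def ord {V E : Type*} (G : LoopGraph V E) : ℤ :=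
  (G.edgeSet.ncard : ℤ) - (Nat.card V : ℤ)

/-- `d`-regularity; a whole-loop contributes `2` to the degree and a half-loop `1`. -/
def IsRegular {V E : Type*} (G : LoopGraph V E) (d : ℕ) : Prop :=
  ∀ v, {e | G.head e = v}.ncard = d

/-- A graph is connected if it has a vertex and any two vertices are joined by a walk. -/
def IsConnected {V E : Type*} (G : LoopGraph V E) : Prop :=
  Nonempty V ∧
    ∀ u v, Relation.ReflTransGen (fun a b => ∃ e, G.tail e = a ∧ G.head e = b) u v

open scoped Classical in
/-- The Hashimoto (non-backtracking) matrix. -/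
noncomputable def hashimoto {V E : Type*} (G : LoopGraph V E) : Matrix E E ℂ :=
  Matrix.of fun e₁ e₂ => if G.head e₁ = G.tail e₂ ∧ G.inv e₁ ≠ e₂ then 1 else 0

open scoped Classical in
/-- The Perron-Frobenius eigenvalue of the Hashimoto matrix, i.e. its spectral radius
(it is `0` if there are no edges). -/
noncomputable def mu1 {V E : Type*} [Fintype E] (G : LoopGraph V E) : ℝ :=
  (spectralRadius ℂ G.hashimoto).toReal

/-- Morphisms of graphs. -/
structure Hom {V E W F : Type*} (G : LoopGraph V E) (H : LoopGraph W F) where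
  onV : V → W
  onE : E → F
  head_onE : ∀ e, H.head (onE e) = onV (G.head e)
  tail_onE : ∀ e, H.tail (onE e) = onV (G.tail e)
  inv_onE : ∀ e, H.inv (onE e) = onE (G.inv e)

/-- Étale morphisms: injective on the edges with a given head and on those with a given tail. -/
def Hom.IsEtale {V E W F : Type*} {G : LoopGraph V E} {H : LoopGraph W F} (π : Hom G H) : Prop :=
  ∀ v, Set.InjOn π.onE {e | G.head e = v} ∧ Set.InjOn π.onE {e | G.tail e = v}

/-- The graph with two vertices joined by `k` edges (and no other edges). -/
def dipole (k : ℕ) : LoopGraph Bool (Fin k × Bool) where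
  head e := e.2
  tail e := !e.2
  inv e := (e.1, !e.2)
  inv_inv e := by simp
  tail_inv e := by simp

/-- Permutation assignments of degree `n` on a graph. -/
abbrev PermAssignment {V E : Type*} (B : LoopGraph V E) (n : ℕ) : Type _ :=
  {σ : E → Equiv.Perm (Fin n) // ∀ e, σ (B.inv e) = (σ e)⁻¹}

/-- The coordinatized cover of degree `n` associated to a permutation assignment. -/
def cover {V E : Type*} (B : LoopGraph V E) {n : ℕ} (σ : B.PermAssignment n) :
    LoopGraph (V × Fin n) (E × Fin n) where
  head x := (B.head x.1, σ.1 x.1 x.2)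
  tail x := (B.tail x.1, x.2)
  inv x := (B.inv x.1, σ.1 x.1 x.2)
  inv_inv x := by simp [σ.2, B.inv_inv]
  tail_inv x := by simp [B.tail_inv]

end LoopGraph

/-- A model over `B`: for each `n` in an infinite set of positive integers, a probability space
whose atoms are coordinatized covers of `B` of degree `n` (the atoms are the elements of positive
probability, i.e. the support of the law). -/
structure CoverModel {V E : Type*} (B : LoopGraph V E) where
  degrees : Set ℕ
  infinite_degrees : degrees.Infinite
  pos_of_mem : ∀ n ∈ degrees, 0 < n
  law : (n : degrees) → PMF (B.PermAssignment n)

namespace CoverModel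

/-- A `B`-graph `π : S → B` occurs in the model: for every sufficiently large degree it is
isomorphic, over `B`, to a subgraph of some atom. -/
def OccursOver {V E W F : Type*} {B : LoopGraph V E} (M : CoverModel B) (S : LoopGraph W F)
    (π : S.Hom B) : Prop :=
  ∃ n₀ : ℕ, ∀ n : M.degrees, n₀ ≤ (n : ℕ) →
    ∃ σ ∈ (M.law n).support, ∃ f : S.Hom (B.cover σ),
      Function.Injective f.onV ∧ Function.Injective f.onE ∧
        (∀ v, (f.onV v).1 = π.onV v) ∧ (∀ e, (f.onE e).1 = π.onE e)

/-- A graph occurs in the model if it does so for some `B`-graph structure. -/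
def Occurs {V E W F : Type*} {B : LoopGraph V E} (M : CoverModel B) (S : LoopGraph W F) : Prop :=
  ∃ π : S.Hom B, M.OccursOver S π

/-- No finite graph with one or more whole-loops occurs in the model. -/
def NoWholeLoopOccurs {V E : Type*} {B : LoopGraph V E} (M : CoverModel B) : Prop :=
  ∀ (W F : Type) [Fintype W] [Fintype F] (S : LoopGraph W F),
    (∃ e, S.IsWholeLoop e) → ¬ M.Occurs S

/-- Every finite étale `B`-graph without half-loops occurs in the model. -/
def EtaleOccurs {V E : Type*} {B : LoopGraph V E} (M : CoverModel B) : Prop :=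
  ∀ (W F : Type) [Fintype W] [Fintype F] (S : LoopGraph W F) (π : S.Hom B),
    π.IsEtale → (∀ e, ¬ S.IsHalfLoop e) → M.OccursOver S π

/-- The orders of the connected finite graphs `S` that occur in the model and satisfy
`μ₁(S) > μ₁(B)^{1/2}`. -/
def tangleOrders {V E : Type*} [Fintype E] {B : LoopGraph V E} (M : CoverModel B) : Set ℤ :=
  {k | ∃ (W F : Type) (_ : Fintype W) (_ : Fintype F) (S : LoopGraph W F),
    S.IsConnected ∧ M.Occurs S ∧ √B.mu1 < S.mu1 ∧ S.ord = k}

/-- The tangle power of a model: the smallest order of a connected graph `S` that occurs in the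
model with `μ₁(S) > μ₁(B)^{1/2}`; it is `+∞` if there is no such graph. -/
noncomputable def tanglePower {V E : Type*} [Fintype E] {B : LoopGraph V E} (M : CoverModel B) :
    EReal :=
  sInf ((fun k : ℤ => ((k : ℝ) : EReal)) '' M.tangleOrders)

end CoverModel

namespace LoopGraph

/-- The possible atoms of the permutation-involution model: half-loops are assigned perfect
matchings (`n` even) or involutions with exactly one fixed point (`n` odd); that the permutation of
a half-loop is an involution is part of being a permutation assignment. -/
def permInvAtoms {V E : Type*} (B : LoopGraph V E) (n : ℕ) : Set (B.PermAssignment n) :=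
  {σ | ∀ e, B.IsHalfLoop e → {i | σ.1 e i = i}.ncard = n % 2}

/-- The possible atoms of the full cycle-involution model: moreover each whole-loop is assigned a
permutation that is a single `n`-cycle. -/
def fullCycleInvAtoms {V E : Type*} (B : LoopGraph V E) (n : ℕ) : Set (B.PermAssignment n) :=
  {σ | σ ∈ B.permInvAtoms n ∧ ∀ e, B.IsWholeLoop e → ∀ i j, (σ.1 e).SameCycle i j}

theorem ncard_fixed_rev (n : ℕ) : {i : Fin n | Fin.revPerm i = i}.ncard = n % 2 := by
  rcases Nat.even_or_odd' n with ⟨k, rfl | rfl⟩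
  · have : {i : Fin (2 * k) | Fin.revPerm i = i} = ∅ := by
      ext i
      simp only [Set.mem_ofPred_eq, Set.mem_empty_iff_false, iff_false, Fin.revPerm_apply, Fin.ext_iff,
        Fin.val_rev]
      omega
    rw [this, Set.ncard_empty]
    omega
  · have : {i : Fin (2 * k + 1) | Fin.revPerm i = i} = {⟨k, by omega⟩} := by
      ext i
      simp only [Set.mem_ofPred_eq, Set.mem_singleton_iff, Fin.revPerm_apply, Fin.ext_iff,
        Fin.val_rev]
      omega
    rw [this, Set.ncard_singleton]
    omega

theorem sameCycle_finRotate (n : ℕ) (i j : Fin n) : (finRotate n).SameCycle i j := by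
  rcases n with _ | _ | n
  · exact i.elim0
  · rw [Fin.fin_one_eq_zero i, Fin.fin_one_eq_zero j]
  · have h := isCycle_finRotate (n := n)
    have hs : ∀ x : Fin (n + 2), finRotate (n + 2) x ≠ x := fun x => by
      have : x ∈ (finRotate (n + 2)).support := by rw [support_finRotate]; exact Finset.mem_univ x
      simpa using this
    exact h.sameCycle (hs i) (hs j)

open scoped Classical in
theorem fullCycleInvAtoms_nonempty {V E : Type*} (B : LoopGraph V E) (n : ℕ) :
    (B.fullCycleInvAtoms n).Nonempty := by
  let r : E → Sym2 E := fun e => s(e, B.inv e)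
  have hr : ∀ e, r (B.inv e) = r e := fun e => by simp [r, B.inv_inv, Sym2.eq_swap]
  let c : E → E := fun e => (r e).out.1
  have hc : ∀ e, c (B.inv e) = c e := fun e => by simp only [c, hr]
  have hc' : ∀ e, c e = e ∨ c e = B.inv e := fun e => by
    have : (r e).out.1 ∈ r e := Sym2.out_fst_mem _
    simpa [r] using this
  refine ⟨⟨fun e => if B.inv e = e then Fin.revPerm
    else if c e = e then finRotate n else (finRotate n)⁻¹, fun e => ?_⟩, fun e he => ?_,
    fun e he i j => ?_⟩
  · by_cases h : B.inv e = e
    · rw [h]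
      simp only [h, if_true]
      ext i
      simp [Equiv.Perm.inv_def]
    · have h2 : ¬ B.inv (B.inv e) = B.inv e := by rw [B.inv_inv]; exact fun h' => h h'.symm
      simp only [h, h2, if_false, hc]
      rcases hc' e with h3 | h3
      · have h4 : ¬ e = B.inv e := fun h' => h h'.symm
        simp [h3, h4]
      · simp [h3, h]
  · have h : B.inv e = e := he
    simpa [h] using ncard_fixed_rev n
  · have h : ¬ B.inv e = e := he.1
    by_cases h3 : c e = e
    · simpa [h, h3] using sameCycle_finRotate n i j
    · simpa [h, h3] using (sameCycle_finRotate n i j).inv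

theorem permInvAtoms_nonempty {V E : Type*} (B : LoopGraph V E) (n : ℕ) :
    (B.permInvAtoms n).Nonempty :=
  (B.fullCycleInvAtoms_nonempty n).mono fun _ h => h.1

/-- The sets of degrees of the basic models: the even or the odd positive integers, and also all
positive integers if there are no half-loops. -/
def BasicDegrees {V E : Type*} (B : LoopGraph V E) (N : Set ℕ) : Prop :=
  N = {n | 0 < n ∧ Even n} ∨ N = {n | Odd n} ∨ ((∀ e, ¬ B.IsHalfLoop e) ∧ N = {n | 0 < n})

theorem BasicDegrees.infinite {V E : Type*} {B : LoopGraph V E} {N : Set ℕ}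
    (h : B.BasicDegrees N) : N.Infinite := by
  rcases h with rfl | rfl | ⟨-, rfl⟩
  · exact Set.infinite_of_forall_exists_gt fun a => ⟨2 * (a + 1), ⟨by omega, by simp⟩, by omega⟩
  · exact Set.infinite_of_forall_exists_gt fun a => ⟨2 * a + 1, ⟨a, rfl⟩, by omega⟩
  · exact Set.infinite_of_forall_exists_gt fun a => ⟨a + 1, Nat.succ_pos a, by omega⟩

theorem BasicDegrees.pos {V E : Type*} {B : LoopGraph V E} {N : Set ℕ}
    (h : B.BasicDegrees N) : ∀ n ∈ N, 0 < n := by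
  rcases h with rfl | rfl | ⟨-, rfl⟩
  · exact fun n hn => hn.1
  · exact fun n hn => hn.pos
  · exact fun n hn => hn

/-- The permutation-involution model (of even or of odd degree, or, in the absence of half-loops,
the permutation model).  The constraints on a permutation assignment concern each edge separately,
so the uniform law makes the permutations of different edges independent, each one uniform among
the permutations allowed for it. -/
noncomputable def permInvModel {V E : Type*} [Finite E] (B : LoopGraph V E) (N : Set ℕ)
    (hN : B.BasicDegrees N) : CoverModel B where
  degrees := N
  infinite_degrees := hN.infinite
  pos_of_mem := hN.pos
  law n := PMF.uniformOfFinset (Set.toFinite (B.permInvAtoms n)).toFinset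
    ((Set.Finite.toFinset_nonempty _).2 (B.permInvAtoms_nonempty n))

/-- The full cycle-involution model (of even or of odd degree, or, in the absence of half-loops,
the full cycle model). -/
noncomputable def fullCycleInvModel {V E : Type*} [Finite E] (B : LoopGraph V E) (N : Set ℕ)
    (hN : B.BasicDegrees N) : CoverModel B where
  degrees := N
  infinite_degrees := hN.infinite
  pos_of_mem := hN.pos
  law n := PMF.uniformOfFinset (Set.toFinite (B.fullCycleInvAtoms n)).toFinset
    ((Set.Finite.toFinset_nonempty _).2 (B.fullCycleInvAtoms_nonempty n))

end LoopGraph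

/-- The basic models over `B`. -/
def CoverModel.IsBasic {V E : Type*} [Finite E] {B : LoopGraph V E} (M : CoverModel B) : Prop :=
  ∃ (N : Set ℕ) (hN : B.BasicDegrees N), M = B.permInvModel N hN ∨ M = B.fullCycleInvModel N hN

/-! Everything rests on one inequality: a connected graph `S` without whole-loops has `μ₁(S) ≤
ord(S) + 1` (`IsConnected.mu1_le_ord_add_one`). If moreover `μ₁(S) > μ₁(B)^{1/2}`, then `ord(S) + 2`
is one of the integers whose minimum is `m'`, so `ord(S) ≥ m' - 2`. The dipole with `m'` edges has
order `m' - 2` and, being `m'`-regular, `μ₁ = m' - 1`; when it occurs, the bound is attained.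

For the inequality, deleting a vertex of degree one, joined to another vertex, changes neither the
order nor the nonzero eigenvalues. Once all degrees are at least two, put `x w = deg w - 2` and let
`L` be the number of half-loops; then `∑ x w = 2 ord - L`. Without whole-loops, a non-backtracking
step leaving `v` either reaches another vertex or is a half-loop. Hence a row of the squared
Hashimoto matrix, for an edge with head `v`, sums to at most `(x v + 1)(2 ord - x v + 1) - L`, which
is at most `(ord + 1)^2` (`sum_card_next_le`).

In the examples, self-loops at one vertex lift to parallel edges between two points of its fibre. A
full cycle of length at least two has no fixed point, which excludes whole-loops. -/

namespace LoopGraph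

/-! ### Counting directed edges, edges and order -/

open scoped Classical in
/-- The directed edges that may follow `e` in a non-backtracking walk. -/
noncomputable def next {V E : Type*} [Fintype E] (G : LoopGraph V E) (e : E) : Finset E :=
  {e' | G.head e = G.tail e' ∧ G.inv e ≠ e'}

open scoped Classical in
/-- The directed edges with tail `v`. -/
noncomputable def out {V E : Type*} [Fintype E] (G : LoopGraph V E) (v : V) : Finset E :=
  {e | G.tail e = v}

open scoped Classical in
/-- The half-loops of a finite graph. -/
noncomputable def halfLoops {V E : Type*} [Fintype E] (G : LoopGraph V E) : Finset E :=
  {e | G.IsHalfLoop e}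

section
variable {V E : Type*} (G : LoopGraph V E)

theorem head_inv (e : E) : G.head (G.inv e) = G.tail e := by
  rw [← G.tail_inv, G.inv_inv]

theorem inv_injective : Function.Injective G.inv :=
  Function.LeftInverse.injective G.inv_inv

theorem pair_inv_eq_iff {e e' : E} :
    ({e, G.inv e} : Set E) = {e', G.inv e'} ↔ e = e' ∨ e = G.inv e' := by
  constructor
  · intro h
    have : e ∈ ({e', G.inv e'} : Set E) := h ▸ Set.mem_insert _ _
    simpa using this
  · rintro (rfl | rfl)
    · rfl
    · rw [G.inv_inv, Set.pair_comm]

theorem mem_next [Fintype E] {e e' : E} :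
    e' ∈ G.next e ↔ G.head e = G.tail e' ∧ G.inv e ≠ e' := by
  simp [next]

theorem mem_out [Fintype E] {v : V} {e : E} : e ∈ G.out v ↔ G.tail e = v := by
  simp [out]

theorem mem_halfLoops [Fintype E] {e : E} : e ∈ G.halfLoops ↔ G.inv e = e := by
  classical
  rw [halfLoops, Finset.mem_filter_univ, IsHalfLoop]

theorem card_next_add_one [Fintype E] (e : E) : (G.next e).card + 1 = (G.out (G.head e)).card := by
  classical
  have h : G.next e = (G.out (G.head e)).erase (G.inv e) := by
    ext e'
    simp only [mem_next, Finset.mem_erase, mem_out]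
    tauto
  rw [h, Finset.card_erase_add_one]
  rw [mem_out, G.tail_inv]

theorem sum_card_out [Fintype V] [Fintype E] : ∑ v, (G.out v).card = Fintype.card E := by
  classical
  rw [← Finset.card_univ, Finset.card_eq_sum_card_fiberwise (f := G.tail) (t := Finset.univ)
    (fun _ _ => Finset.mem_coe.2 (Finset.mem_univ _))]
  refine Finset.sum_congr rfl fun v _ => congrArg _ ?_
  ext e
  simp [mem_out]

theorem card_out_eq_ncard_head [Fintype E] (v : V) :
    (G.out v).card = {e | G.head e = v}.ncard := by
  classical
  have h : {e | G.head e = v} = ((G.out v).image G.inv : Finset E) := by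
    ext e
    simp only [Set.mem_ofPred_eq, Finset.coe_image, Set.mem_image, Finset.mem_coe, mem_out]
    constructor
    · exact fun h => ⟨G.inv e, by rw [G.tail_inv, h], G.inv_inv e⟩
    · rintro ⟨e', h, rfl⟩
      rw [G.head_inv, h]
  rw [h, Set.ncard_coe_finset, Finset.card_image_of_injective _ G.inv_injective]

theorem two_mul_ncard_edgeSet [Fintype E] :
    2 * G.edgeSet.ncard = Fintype.card E + G.halfLoops.card := by
  classical
  let p : E → Set E := fun e => {e, G.inv e}
  have hes : G.edgeSet = (Finset.univ.image p : Finset (Set E)) := by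
    ext o
    simp only [edgeSet, Set.mem_ofPred_eq, Finset.coe_image, Finset.coe_univ, Set.image_univ,
      Set.mem_range, p, eq_comm]
  rw [hes, Set.ncard_coe_finset, ← Finset.card_univ,
    Finset.card_eq_sum_card_image p Finset.univ,
    Finset.card_eq_sum_card_fiberwise (s := G.halfLoops) (f := p) (t := Finset.univ.image p)
      (fun e _ => by simp),
    ← Finset.sum_add_distrib, mul_comm, ← smul_eq_mul, ← Finset.sum_const]
  refine Finset.sum_congr rfl fun o ho => ?_
  obtain ⟨e, -, rfl⟩ := Finset.mem_image.1 ho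
  -- Fibrewise over the orbits: an orbit of size two has no half-loop, an orbit of size one has one,
  -- so both kinds contribute two.
  have h1 : (Finset.univ.filter fun e' => p e' = p e) = {e, G.inv e} := by
    ext e'
    simp [p, G.pair_inv_eq_iff]
  have h2 : (G.halfLoops.filter fun e' => p e' = p e) = if G.inv e = e then {e} else ∅ := by
    ext e'
    simp only [Finset.mem_filter, mem_halfLoops, p, G.pair_inv_eq_iff]
    split_ifs with h
    · simp only [h, or_self, Finset.mem_singleton, and_iff_right_iff_imp]
      rintro rfl
      exact h
    · simp only [Finset.notMem_empty, iff_false, not_and, not_or]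
      intro h'
      constructor
      · rintro rfl
        exact h h'
      · rintro rfl
        exact h (G.inv_inv e ▸ h').symm
  rw [h1, h2]
  split_ifs with h
  · simp [h]
  · rw [Finset.card_pair (Ne.symm h)]
    simp

theorem two_mul_ord [Fintype V] [Fintype E] :
    2 * G.ord = Fintype.card E + G.halfLoops.card - 2 * Fintype.card V := by
  have h := G.two_mul_ncard_edgeSet
  rw [ord, Nat.card_eq_fintype_card]
  omega

/-! ### Eigenvalue bounds for the Hashimoto matrix -/

/-- `f` is an eigenfunction of the Hashimoto matrix for `z`. -/
def IsEigenfunction [Fintype E] (z : ℂ) (f : E → ℂ) : Prop :=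
  f ≠ 0 ∧ ∀ e, z * f e = ∑ e' ∈ G.next e, f e'

open scoped Classical in
theorem mem_spectrum_hashimoto [Fintype E] (z : ℂ) :
    z ∈ spectrum ℂ G.hashimoto ↔ ∃ f, G.IsEigenfunction z f := by
  rw [spectrum.mem_iff, Matrix.isUnit_iff_isUnit_det, isUnit_iff_ne_zero, not_not,
    ← Matrix.exists_mulVec_eq_zero_iff]
  refine exists_congr fun f => and_congr_right fun _ => ?_
  rw [Matrix.sub_mulVec, sub_eq_zero, Matrix.algebraMap_eq_diagonal, funext_iff]
  refine forall_congr' fun e => ?_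
  rw [Matrix.mulVec_diagonal]
  simp [hashimoto, Matrix.mulVec, dotProduct, next, Finset.sum_filter]

theorem mu1_le [Fintype E] {c : ℝ} (hc : 0 ≤ c)
    (h : ∀ z f, G.IsEigenfunction z f → ‖z‖ ≤ c) : G.mu1 ≤ c := by
  classical
  refine ENNReal.toReal_le_of_le_ofReal hc (iSup₂_le fun z hz => ?_)
  obtain ⟨f, hf⟩ := (G.mem_spectrum_hashimoto z).1 hz
  rw [← enorm_eq_nnnorm, ← ofReal_norm]
  exact ENNReal.ofReal_le_ofReal (h z f hf)

theorem le_mu1 [Fintype E] {c : ℝ} {z : ℂ} {f : E → ℂ}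
    (h : ∀ z f, G.IsEigenfunction z f → ‖z‖ ≤ c) (hf : G.IsEigenfunction z f) :
    ‖z‖ ≤ G.mu1 := by
  classical
  -- `ENNReal.toReal` sends `⊤` to `0`, so a lower bound for `mu1` needs a finite spectral radius;
  -- `h` supplies it.
  have hfin : spectralRadius ℂ G.hashimoto ≠ ⊤ := by
    refine ne_top_of_le_ne_top (ENNReal.ofReal_ne_top (r := c)) (iSup₂_le fun w hw => ?_)
    obtain ⟨g, hg⟩ := (G.mem_spectrum_hashimoto w).1 hw
    rw [← enorm_eq_nnnorm, ← ofReal_norm]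
    exact ENNReal.ofReal_le_ofReal (h w g hg)
  refine (ENNReal.ofReal_le_iff_le_toReal hfin).1 ?_
  rw [ofReal_norm]
  exact le_iSup₂ (f := fun (k : ℂ) (_ : k ∈ spectrum ℂ G.hashimoto) => (‖k‖ₑ : ENNReal)) z
    ((G.mem_spectrum_hashimoto z).2 ⟨f, hf⟩)

theorem IsEigenfunction.exists_max [Fintype E] {z : ℂ} {f : E → ℂ} (hf : G.IsEigenfunction z f) :
    ∃ e, 0 < ‖f e‖ ∧ ∀ e', ‖f e'‖ ≤ ‖f e‖ := by
  obtain ⟨e₀, he₀⟩ := Function.ne_iff.1 hf.1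
  have : Nonempty E := ⟨e₀⟩
  obtain ⟨e, he⟩ := Finite.exists_max fun e => ‖f e‖
  exact ⟨e, (norm_pos_iff.2 he₀).trans_le (he e₀), he⟩

theorem IsEigenfunction.norm_le_of_card_next_le [Fintype E] {z : ℂ} {f : E → ℂ}
    (hf : G.IsEigenfunction z f) {c : ℝ} (hc : ∀ e, ((G.next e).card : ℝ) ≤ c) : ‖z‖ ≤ c := by
  obtain ⟨e, hpos, hmax⟩ := hf.exists_max
  refine le_of_mul_le_mul_right ?_ hpos
  rw [← norm_mul, hf.2]
  calc ‖∑ e' ∈ G.next e, f e'‖ ≤ ∑ e' ∈ G.next e, ‖f e‖ :=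
        norm_sum_le_of_le _ fun e' _ => hmax e'
    _ ≤ c * ‖f e‖ := by
        rw [Finset.sum_const, nsmul_eq_mul]
        exact mul_le_mul_of_nonneg_right (hc e) hpos.le

/-- The eigenvalue equation is applied twice at an edge where `‖f‖` is maximal; the sum is the row
sum of the squared matrix. -/
theorem IsEigenfunction.norm_sq_le_of_sum_card_next_le [Fintype E] {z : ℂ} {f : E → ℂ}
    (hf : G.IsEigenfunction z f) {c : ℝ}
    (hc : ∀ e, ((∑ e' ∈ G.next e, (G.next e').card : ℕ) : ℝ) ≤ c) : ‖z‖ ^ 2 ≤ c := by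
  obtain ⟨e, hpos, hmax⟩ := hf.exists_max
  refine le_of_mul_le_mul_right ?_ hpos
  rw [← norm_pow, ← norm_mul, sq, mul_assoc, hf.2, Finset.mul_sum]
  calc ‖∑ e' ∈ G.next e, z * f e'‖ ≤ ∑ e' ∈ G.next e, (G.next e').card * ‖f e‖ := by
        refine norm_sum_le_of_le _ fun e' _ => ?_
        rw [hf.2, ← nsmul_eq_mul, ← Finset.sum_const]
        exact norm_sum_le_of_le _ fun e'' _ => hmax e''
    _ ≤ c * ‖f e‖ := by
        rw [← Finset.sum_mul, ← Nat.cast_sum]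
        exact mul_le_mul_of_nonneg_right (hc e) hpos.le

/-- All row sums equal `d - 1`, so the constant function is an eigenfunction attaining the row-sum
bound. -/
theorem mu1_of_isRegular [Fintype E] [Nonempty V] {d : ℕ} (hd : 1 ≤ d)
    (hG : G.IsRegular d) : G.mu1 = (d : ℝ) - 1 := by
  have hd' : (1 : ℝ) ≤ d := by exact_mod_cast hd
  have hnext : ∀ e, ((G.next e).card : ℝ) = d - 1 := fun e => by
    have h := G.card_next_add_one e
    rw [card_out_eq_ncard_head, hG] at h
    rw [← h]
    simp
  have hbound : ∀ z f, G.IsEigenfunction z f → ‖z‖ ≤ (d : ℝ) - 1 :=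
    fun z f hf => hf.norm_le_of_card_next_le G fun e => (hnext e).le
  refine le_antisymm (G.mu1_le (by linarith) hbound) ?_
  have hone : G.IsEigenfunction (((d : ℝ) - 1 : ℝ) : ℂ) 1 := by
    constructor
    · obtain ⟨v⟩ := ‹Nonempty V›
      obtain ⟨e, -⟩ : {e | G.head e = v}.Nonempty := by
        refine Set.nonempty_of_ncard_ne_zero ?_
        rw [hG v]
        omega
      exact Function.ne_iff.2 ⟨e, one_ne_zero⟩
    · intro e
      rw [← hnext e]
      simp
  have h := G.le_mu1 hbound hone
  rwa [Complex.norm_real, Real.norm_of_nonneg (by linarith)] at h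

/-! ### The count of two-step continuations -/

/-- In a graph without whole-loops and of minimal degree at least two, there are at most
`(ord + 1) ^ 2` non-backtracking continuations of length two of a given directed edge. -/
theorem sum_card_next_le [Fintype V] [Fintype E] (hG : ∀ e, ¬ G.IsWholeLoop e)
    (hdeg : ∀ v, 2 ≤ (G.out v).card) (e : E) :
    ((∑ e' ∈ G.next e, (G.next e').card : ℕ) : ℤ) ≤ (G.ord + 1) ^ 2 := by
  classical
  let x : V → ℤ := fun v => (G.out v).card - 2
  have hx : ∀ v, 0 ≤ x v := fun v => by have := hdeg v; simp only [x]; omega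
  have hnext : ∀ e, ((G.next e).card : ℤ) = x (G.head e) + 1 := fun e => by
    have := G.card_next_add_one e
    simp only [x]; omega
  set v := G.head e with hv
  set X : ℤ := ∑ w ∈ Finset.univ.erase v, x w with hX
  set L : ℤ := (G.halfLoops.card : ℤ) with hL
  have hXL : x v + X + L = 2 * G.ord := by
    rw [hX, Finset.add_sum_erase _ _ (Finset.mem_univ v), two_mul_ord, ← G.sum_card_out]
    simp only [x, Finset.sum_sub_distrib, Finset.sum_const, Finset.card_univ, Nat.cast_sum]
    simp
    ring
  -- Only a half-loop can lead from `v` back to `v`; any other `e'` ends at a vertex whose excess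
  -- degree is a summand of `X`.
  have hle : ∀ e' ∈ G.next e, x (G.head e') ≤ X + if e' ∈ G.halfLoops then x v else 0 := by
    intro e' he'
    have ht : G.head e = G.tail e' := (G.mem_next.1 he').1
    have hX0 : 0 ≤ X := Finset.sum_nonneg fun w _ => hx w
    by_cases hh : G.head e' = v
    · have : G.inv e' = e' := by
        by_contra h
        exact hG e' ⟨h, by rw [hh, hv, ht]⟩
      rw [if_pos (G.mem_halfLoops.2 this), hh]
      linarith
    · have : x (G.head e') ≤ X :=
        Finset.single_le_sum (f := x) (fun w _ => hx w)
          (Finset.mem_erase.2 ⟨hh, Finset.mem_univ _⟩)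
      split_ifs
      · linarith [hx v]
      · linarith
  have hhalf : ∑ e' ∈ G.next e, (if e' ∈ G.halfLoops then x v else 0) ≤ L * x v := by
    rw [← Finset.sum_filter, Finset.sum_const, nsmul_eq_mul]
    refine mul_le_mul_of_nonneg_right ?_ (hx v)
    rw [hL, Nat.cast_le]
    exact Finset.card_le_card fun e' he' => (Finset.mem_filter.1 he').2
  have hsum : ((∑ e' ∈ G.next e, (G.next e').card : ℕ) : ℤ) ≤
      (x v + 1) * X + L * x v + (x v + 1) := by
    rw [Nat.cast_sum]
    calc ∑ e' ∈ G.next e, ((G.next e').card : ℤ)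
        = ∑ e' ∈ G.next e, x (G.head e') + (x v + 1) := by
          rw [Finset.sum_congr rfl fun e' _ => hnext e', Finset.sum_add_distrib, hv, ← hnext e]
          simp
      _ ≤ ∑ e' ∈ G.next e, (X + if e' ∈ G.halfLoops then x v else 0) + (x v + 1) :=
          add_le_add_left (Finset.sum_le_sum hle) _
      _ ≤ (x v + 1) * X + L * x v + (x v + 1) := by
          rw [Finset.sum_add_distrib, Finset.sum_const, nsmul_eq_mul, hnext e]
          linarith
  have hL0 : 0 ≤ L := by positivity
  have hX' : X = 2 * G.ord - x v - L := by linarith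
  rw [hX'] at hsum
  -- The right side of `hsum` is now `(ord + 1)^2 - (x v - ord)^2 - L`.
  linarith [sq_nonneg (x v - G.ord)]

theorem ord_nonneg_of_two_le_card_out [Fintype V] [Fintype E]
    (hdeg : ∀ v, 2 ≤ (G.out v).card) : 0 ≤ G.ord := by
  have h := G.two_mul_ord
  have h2 : ∑ _v : V, 2 ≤ ∑ v, (G.out v).card := Finset.sum_le_sum fun v _ => hdeg v
  rw [sum_card_out] at h2
  simp only [Finset.sum_const, Finset.card_univ, smul_eq_mul] at h2
  omega

end

/-! ### Pruning a vertex of degree one -/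

/-- The graph obtained by deleting a vertex and all edges incident upon it. -/
def deleteVertex {V E : Type*} (G : LoopGraph V E) (v : V) :
    LoopGraph {w // w ≠ v} {e // G.head e ≠ v ∧ G.tail e ≠ v} where
  head e := ⟨G.head e.1, e.2.1⟩
  tail e := ⟨G.tail e.1, e.2.2⟩
  inv e := ⟨G.inv e.1, by rw [G.head_inv]; exact e.2.2, by rw [G.tail_inv]; exact e.2.1⟩
  inv_inv e := Subtype.ext (G.inv_inv e.1)
  tail_inv e := Subtype.ext (G.tail_inv e.1)

section leaf
variable {V E : Type*} (G : LoopGraph V E) {v : V} {a : E}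

theorem IsConnected.subsingleton_of_out {G : LoopGraph V E} (hG : G.IsConnected)
    (h : ∀ e, G.tail e = v → G.head e = v) (w : V) : w = v := by
  have := hG.2 v w
  induction this with
  | refl => rfl
  | tail _ hs ih =>
    obtain ⟨e, h1, h2⟩ := hs
    rw [← h2]
    exact h e (h1.trans ih)

theorem IsConnected.deleteVertex (hG : G.IsConnected) (hva : ∀ e, G.tail e = v ↔ e = a)
    (ha : G.head a ≠ v) : (G.deleteVertex v).IsConnected := by
  classical
  refine ⟨⟨⟨G.head a, ha⟩⟩, ?_⟩
  -- Retraction onto the remaining vertices: `v` goes to its only neighbour, so each step of a walk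
  -- is kept or collapsed.
  let r : V → {w // w ≠ v} := fun w => if h : w = v then ⟨G.head a, ha⟩ else ⟨w, h⟩
  have hr : ∀ w : {w // w ≠ v}, r w = w := fun w => by simp [r, w.2]
  intro u w
  rw [← hr u, ← hr w]
  generalize u.1 = u', w.1 = w', hG.2 u.1 w.1 = h
  induction h with
  | refl => exact .refl
  | tail _ hs ih =>
    refine ih.trans ?_
    obtain ⟨e, rfl, rfl⟩ := hs
    by_cases h1 : G.tail e = v
    · obtain rfl := (hva e).1 h1
      rw [show r (G.tail e) = r (G.head e) by simp [r, h1, ha]]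
    · by_cases h2 : G.head e = v
      · have h3 : G.inv e = a := (hva _).1 (by rw [G.tail_inv, h2])
        have h4 : G.head a = G.tail e := by rw [← h3, G.head_inv]
        rw [show r (G.tail e) = r (G.head e) by simp [r, h1, h2, h4]]
      · refine .single ⟨⟨e, h2, h1⟩, ?_, ?_⟩ <;> simp [r, h1, h2, LoopGraph.deleteVertex]

open scoped Classical in
theorem ord_deleteVertex [Fintype V] [Fintype E] (hva : ∀ e, G.tail e = v ↔ e = a)
    (ha : G.head a ≠ v) : (G.deleteVertex v).ord = G.ord := by
  have hta : G.tail a = v := (hva a).2 rfl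
  have h1 := G.two_mul_ord
  have h2 := (G.deleteVertex v).two_mul_ord
  have hV : Fintype.card {w // w ≠ v} + 1 = Fintype.card V := by
    rw [Fintype.card_subtype, Finset.filter_ne', Finset.card_erase_add_one (Finset.mem_univ v),
      Finset.card_univ]
  have hne : a ≠ G.inv a := fun h => ha (by rw [← G.tail_inv, ← h, hta])
  have hE : Fintype.card {e // G.head e ≠ v ∧ G.tail e ≠ v} + 2 = Fintype.card E := by
    rw [← Finset.card_pair (a := a) (b := G.inv a) hne, Fintype.card_subtype, ← Finset.card_univ (α := E)]
    have h3 : ({a, G.inv a} : Finset E) = Finset.univ.filter fun e => ¬ (G.head e ≠ v ∧ G.tail e ≠ v) := by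
      ext e
      have : G.head e = v ↔ e = G.inv a := by
        rw [← G.tail_inv, hva]
        exact ⟨fun h => by rw [← h, G.inv_inv], fun h => by rw [h, G.inv_inv]⟩
      simp only [Finset.mem_insert, Finset.mem_singleton, Finset.mem_filter, Finset.mem_univ,
        true_and, ← this, ← hva]
      tauto
    rw [h3, Finset.card_filter_add_card_filter_not]
  have hL : (G.deleteVertex v).halfLoops.card = G.halfLoops.card := by
    refine Finset.card_bij (fun e _ => e.1) (fun e he => ?_) (fun _ _ _ _ h => Subtype.ext h)
      fun e he => ?_
    · rw [mem_halfLoops] at he ⊢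
      exact congrArg Subtype.val he
    · rw [mem_halfLoops] at he
      have h3 : G.tail e ≠ v := fun h => by
        obtain rfl := (hva e).1 h
        exact hne he.symm
      have h4 : G.head e ≠ v := by rwa [← G.tail_inv, he]
      exact ⟨⟨e, h4, h3⟩, (mem_halfLoops _).2 (Subtype.ext he), rfl⟩
  omega

theorem not_isWholeLoop_deleteVertex (hG : ∀ e, ¬ G.IsWholeLoop e) (e) :
    ¬ (G.deleteVertex v).IsWholeLoop e := fun h =>
  hG e.1 ⟨fun h' => h.1 (Subtype.ext h'), congrArg Subtype.val h.2⟩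

open scoped Classical in
-- An edge into `v` has no non-backtracking continuation, so `f` vanishes there when `z ≠ 0`. The
-- value at `a` is determined by the surviving edges, so the restriction is still nonzero.
theorem IsEigenfunction.deleteVertex [Fintype E] (hva : ∀ e, G.tail e = v ↔ e = a)
    {z : ℂ} (hz : z ≠ 0) {f : E → ℂ} (hf : G.IsEigenfunction z f) :
    (G.deleteVertex v).IsEigenfunction z fun e => f e.1 := by
  have hinto : ∀ e, G.head e = v → f e = 0 := fun e he => by
    have h : G.next e = ∅ := by
      rw [Finset.eq_empty_iff_forall_notMem]
      intro e' he'
      obtain ⟨h1, h2⟩ := G.mem_next.1 he'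
      have h3 : G.inv e = a := (hva _).1 (by rw [G.tail_inv, he])
      exact h2 (h3.trans ((hva e').1 (h1.symm.trans he)).symm)
    have := hf.2 e
    rw [h, Finset.sum_empty] at this
    exact (mul_eq_zero.1 this).resolve_left hz
  have hsum : ∀ e, G.head e ≠ v → (∑ e' ∈ G.next e, f e') =
      ∑ e' : {e // G.head e ≠ v ∧ G.tail e ≠ v} with e'.1 ∈ G.next e, f e'.1 := fun e he => by
    rw [← Finset.sum_subtype_map_embedding (s := Finset.univ.filter _) (f := fun e' => f e'.1)
      (g := f) fun _ _ => rfl]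
    symm
    refine Finset.sum_subset ?_ fun e' h1 h2 => ?_
    · intro e' he'
      obtain ⟨e'', h1, rfl⟩ := Finset.mem_map.1 he'
      exact (Finset.mem_filter.1 h1).2
    · refine hinto e' (by_contra fun h3 => h2 ?_)
      simp only [Finset.mem_map, Finset.mem_filter, Finset.mem_univ, true_and,
        Function.Embedding.subtype_apply, Subtype.exists, exists_and_left, exists_prop,
        exists_eq_right_right]
      exact ⟨h1, h3, (G.mem_next.1 h1).1 ▸ he⟩
  refine ⟨fun h0 => hf.1 ?_, fun e => ?_⟩
  · have h1 : ∀ e : {e // G.head e ≠ v ∧ G.tail e ≠ v}, f e.1 = 0 := fun e => congrFun h0 e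
    funext e
    by_cases h2 : G.head e = v
    · exact hinto e h2
    · have := hf.2 e
      rw [hsum e h2, Finset.sum_eq_zero fun e' _ => h1 e'] at this
      exact (mul_eq_zero.1 this).resolve_left hz
  · show z * f e.1 = _
    rw [hf.2, hsum _ e.2.1]
    refine Finset.sum_congr ?_ fun _ _ => rfl
    ext e'
    simp [mem_next, LoopGraph.deleteVertex, Subtype.ext_iff]

end leaf

/-! ### Spectral radius against order -/

open scoped Classical in
-- Induction on the number of vertices by pruning. The nonnegativity is carried along because
-- pruning says nothing about the eigenvalue `0`.
theorem IsConnected.norm_le_ord_add_one {V E : Type*} [Fintype V] [Fintype E] {G : LoopGraph V E}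
    (hG : G.IsConnected) (hw : ∀ e, ¬ G.IsWholeLoop e) :
    0 ≤ G.ord + 1 ∧ ∀ z f, G.IsEigenfunction z f → ‖z‖ ≤ (G.ord : ℝ) + 1 := by
  induction hn : Fintype.card V generalizing V E with
  | zero => exact absurd hn (@Fintype.card_ne_zero _ _ hG.1)
  | succ n ih =>
    by_cases hdeg : ∀ v, 2 ≤ (G.out v).card
    · have h0 := G.ord_nonneg_of_two_le_card_out hdeg
      refine ⟨by omega, fun z f hf => ?_⟩
      have h0' : (0 : ℝ) ≤ G.ord := by exact_mod_cast h0
      refine le_of_sq_le_sq ?_ (by linarith)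
      refine hf.norm_sq_le_of_sum_card_next_le G fun e => ?_
      exact_mod_cast G.sum_card_next_le hw hdeg e
    push Not at hdeg
    obtain ⟨v, hv⟩ := hdeg
    by_cases hloop : ∀ e, G.tail e = v → G.head e = v
    · have hV := hG.subsingleton_of_out hloop
      have hcard : Fintype.card V = 1 := Fintype.card_eq_one_iff.2 ⟨v, hV⟩
      -- The graph is one vertex with at most a half-loop, which cannot follow itself.
      have hsub : ∀ e e' : E, e = e' := fun e e' =>
        Finset.card_le_one.1 (Nat.lt_succ_iff.1 hv) e (G.mem_out.2 (hV _)) e' (G.mem_out.2 (hV _))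
      have h0 : 0 ≤ G.ord + 1 := by
        have := G.two_mul_ord
        omega
      refine ⟨h0, fun z f hf => ?_⟩
      have h0' : (0 : ℝ) ≤ (G.ord : ℝ) + 1 := by exact_mod_cast h0
      refine (hf.norm_le_of_card_next_le G (c := 0) fun e => ?_).trans h0'
      have : G.next e = ∅ := Finset.eq_empty_iff_forall_notMem.2 fun e' he' =>
        (G.mem_next.1 he').2 (hsub _ _)
      simp [this]
    · push Not at hloop
      obtain ⟨a, hta, ha⟩ := hloop
      have hva : ∀ e, G.tail e = v ↔ e = a := fun e =>
        ⟨fun h => Finset.card_le_one.1 (Nat.lt_succ_iff.1 hv) e (G.mem_out.2 h) a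
          (G.mem_out.2 hta), fun h => h ▸ hta⟩
      have hn' : Fintype.card {w // w ≠ v} = n := by
        rw [Fintype.card_subtype, Finset.filter_ne', Finset.card_erase_of_mem (Finset.mem_univ v),
          Finset.card_univ, hn, Nat.add_sub_cancel]
      obtain ⟨h0, hz⟩ := ih (hG.deleteVertex G hva ha) (G.not_isWholeLoop_deleteVertex hw) hn'
      rw [G.ord_deleteVertex hva ha] at h0 hz
      refine ⟨h0, fun z f hf => ?_⟩
      by_cases hz0 : z = 0
      · rw [hz0, norm_zero]
        exact_mod_cast h0
      · exact hz z _ (hf.deleteVertex G hva hz0)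

theorem IsConnected.mu1_le_ord_add_one {V E : Type*} [Fintype V] [Fintype E] {G : LoopGraph V E}
    (hG : G.IsConnected) (hw : ∀ e, ¬ G.IsWholeLoop e) : G.mu1 ≤ (G.ord : ℝ) + 1 :=
  G.mu1_le (by exact_mod_cast (hG.norm_le_ord_add_one hw).1) (hG.norm_le_ord_add_one hw).2

end LoopGraph
namespace LoopGraph

/-! ### Dipoles -/

theorem isConnected_dipole {m : ℕ} (hm : 1 ≤ m) : (dipole m).IsConnected := by
  refine ⟨inferInstance, fun u w => ?_⟩
  by_cases h : u = w
  · exact h ▸ .refl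
  · exact .single ⟨(⟨0, hm⟩, w), by cases u <;> cases w <;> simp_all [dipole], rfl⟩

theorem ord_dipole (m : ℕ) : (dipole m).ord = m - 2 := by
  have h := (dipole m).two_mul_ord
  have hL : (dipole m).halfLoops = ∅ := Finset.eq_empty_iff_forall_notMem.2 fun e he => by
    have := congrArg Prod.snd ((mem_halfLoops _).1 he)
    simp [dipole] at this
  rw [hL] at h
  simp only [Fintype.card_prod, Fintype.card_fin, Fintype.card_bool, Finset.card_empty] at h
  push_cast at h
  linarith

theorem isRegular_dipole (m : ℕ) : (dipole m).IsRegular m := fun v => by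
  have h : {e : Fin m × Bool | (dipole m).head e = v} = (fun i => (i, v)) '' Set.univ := by
    ext ⟨i, b⟩
    simp [dipole, eq_comm]
  rw [h, Set.ncard_image_of_injective _ fun i j hij => congrArg Prod.fst hij, Set.ncard_univ,
    Nat.card_eq_fintype_card, Fintype.card_fin]

theorem mu1_dipole {m : ℕ} (hm : 1 ≤ m) : (dipole m).mu1 = (m : ℝ) - 1 :=
  mu1_of_isRegular _ hm (isRegular_dipole m)

/-! ### Lifting self-loops to parallel edges -/

section selfLoops
variable {V E : Type*} (B : LoopGraph V E)

/-- The morphism from a dipole determined by a family of self-loops at one vertex. -/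
def dipoleHom {m : ℕ} (v : V) (l : Fin m → E) (ht : ∀ k, B.tail (l k) = v)
    (hh : ∀ k, B.head (l k) = v) : (dipole m).Hom B where
  onV _ := v
  onE x := if x.2 then l x.1 else B.inv (l x.1)
  head_onE x := by split_ifs <;> simp [B.head_inv, ht, hh]
  tail_onE x := by split_ifs <;> simp [B.tail_inv, ht, hh]
  inv_onE x := by rcases x with ⟨k, _ | _⟩ <;> simp [dipole, B.inv_inv]

/-- Edges with a common head, or a common tail, have the same orientation, so the values of `l` may
be half-loops. -/
theorem isEtale_dipoleHom {m : ℕ} (v : V) (l : Fin m → E) (ht : ∀ k, B.tail (l k) = v)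
    (hh : ∀ k, B.head (l k) = v) (hl : Function.Injective l) :
    (B.dipoleHom v l ht hh).IsEtale := by
  have key : ∀ b i j, (B.dipoleHom v l ht hh).onE (i, b) = (B.dipoleHom v l ht hh).onE (j, b) →
      i = j := by
    rintro (_ | _) i j h
    · exact hl (B.inv_injective (by simpa [dipoleHom] using h))
    · exact hl (by simpa [dipoleHom] using h)
  refine fun w => ⟨?_, ?_⟩
  · rintro ⟨i, b⟩ h1 ⟨j, c⟩ h2 h
    obtain rfl : b = c := (show b = w from h1).trans (show c = w from h2).symm
    rw [key b i j h]
  · rintro ⟨i, b⟩ h1 ⟨j, c⟩ h2 h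
    obtain rfl : b = c := Bool.not_inj ((show (!b) = w from h1).trans (show (!c) = w from h2).symm)
    rw [key b i j h]

/-- Representatives for the orbits of the involution. -/
theorem exists_representative : ∃ c : E → E,
    (∀ e, c (B.inv e) = c e) ∧ ∀ e, c e = e ∨ c e = B.inv e := by
  let r : E → Sym2 E := fun e => s(e, B.inv e)
  have hr : ∀ e, r (B.inv e) = r e := fun e => by simp [r, B.inv_inv, Sym2.eq_swap]
  refine ⟨fun e => (r e).out.1, fun e => by simp only [hr], fun e => ?_⟩
  have : (r e).out.1 ∈ r e := Sym2.out_fst_mem _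
  simpa [r] using this

/-- If `m` self-loops are incident upon `v`, there are representatives of their orbits that
are pairwise distinct and fixed by a given choice of representatives of all orbits. -/
theorem exists_selfLoop_family [Finite E] {c : E → E} (hc : ∀ e, c (B.inv e) = c e)
    (hc' : ∀ e, c e = e ∨ c e = B.inv e) {v : V} {m : ℕ} (hm : m ≤ (B.selfLoopsAt v).ncard) :
    ∃ l : Fin m → E, (∀ k, B.tail (l k) = v) ∧ (∀ k, B.head (l k) = v) ∧ (∀ k, c (l k) = l k) ∧
      Function.Injective l := by
  classical
  have hsub : B.selfLoopsAt v ⊆ (fun e => ({e, B.inv e} : Set E)) ''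
      {e | B.tail e = v ∧ B.head e = v ∧ c e = e} := by
    rintro o ⟨e, h1, h2, rfl⟩
    rcases hc' e with h | h
    · exact ⟨e, ⟨h1, h2, h⟩, rfl⟩
    · refine ⟨B.inv e, ⟨by rw [B.tail_inv, h2], by rw [B.head_inv, h1], by rw [hc, h]⟩, ?_⟩
      exact B.pair_inv_eq_iff.2 (Or.inr rfl)
  have hcard : m ≤ {e | B.tail e = v ∧ B.head e = v ∧ c e = e}.ncard :=
    hm.trans ((Set.ncard_le_ncard hsub (Set.toFinite _)).trans (Set.ncard_image_le (Set.toFinite _)))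
  obtain ⟨t, ht, htm⟩ := Set.exists_subset_card_eq hcard
  have : Finite t := (Set.toFinite t)
  have hcard' : Nat.card t = m := (Nat.card_coe_set_eq t).trans htm
  let g : t ≃ Fin m := Finite.equivFinOfCardEq hcard'
  exact ⟨fun k => (g.symm k).1, fun k => (ht (g.symm k).2).1, fun k => (ht (g.symm k).2).2.1,
    fun k => (ht (g.symm k).2).2.2, fun i j h => g.symm.injective (Subtype.ext h)⟩

open scoped Classical in
/-- An atom of the full cycle-involution model that sends `0` to the last point along every
representative of an orbit. -/
theorem exists_fullCycleInvAtom_zero_last {c : E → E} (hc : ∀ e, c (B.inv e) = c e)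
    (hc' : ∀ e, c e = e ∨ c e = B.inv e) (n : ℕ) :
    ∃ σ ∈ B.fullCycleInvAtoms (n + 1), ∀ e, c e = e → σ.1 e 0 = Fin.last n := by
  -- Reversal exchanges `0` and the last point, and the inverse rotation takes `0` to the last
  -- point, so half-loops and whole-loops lift to parallel edges.
  refine ⟨⟨fun e => if B.inv e = e then Fin.revPerm
    else if c e = e then (finRotate (n + 1))⁻¹ else finRotate (n + 1), fun e => ?_⟩,
    ⟨fun e he => ?_, fun e he i j => ?_⟩, fun e he => ?_⟩
  · by_cases h : B.inv e = e
    · rw [h]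
      simp only [h, if_true]
      ext i
      simp [Equiv.Perm.inv_def]
    · have h2 : ¬ B.inv (B.inv e) = B.inv e := by rw [B.inv_inv]; exact fun h' => h h'.symm
      simp only [h, h2, if_false, hc]
      rcases hc' e with h3 | h3
      · have h4 : ¬ e = B.inv e := fun h' => h h'.symm
        simp [h3, h4]
      · simp [h3, h]
  · have h : B.inv e = e := he
    simpa [h] using ncard_fixed_rev (n + 1)
  · have h : ¬ B.inv e = e := he.1
    by_cases h3 : c e = e
    · simpa [h, h3] using (sameCycle_finRotate (n + 1) i j).inv
    · simpa [h, h3] using sameCycle_finRotate (n + 1) i j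
  · by_cases h : B.inv e = e
    · simp [h]
    · simp only [h, he, if_true, if_false]
      rw [Equiv.Perm.inv_eq_iff_eq, finRotate_last]

/-- The morphism from a dipole to a cover determined by the lifts of a family of self-loops. -/
def dipoleHomCover {m n : ℕ} (σ : B.PermAssignment n) (v : V) (l : Fin m → E)
    (ht : ∀ k, B.tail (l k) = v) (hh : ∀ k, B.head (l k) = v) (i j : Fin n)
    (hij : ∀ k, σ.1 (l k) i = j) : (dipole m).Hom (B.cover σ) where
  onV b := (v, if b then j else i)
  onE x := if x.2 then (l x.1, i) else (B.inv (l x.1), j)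
  head_onE x := by
    rcases x with ⟨k, _ | _⟩
    · simp [dipole, cover, B.head_inv, ht, σ.2, ← hij k]
    · simp [dipole, cover, hh, hij]
  tail_onE x := by rcases x with ⟨k, _ | _⟩ <;> simp [dipole, cover, B.tail_inv, ht, hh]
  inv_onE x := by
    rcases x with ⟨k, _ | _⟩
    · simp [dipole, cover, B.inv_inv, σ.2, ← hij k]
    · simp [dipole, cover, hij]

end selfLoops

end LoopGraph

/-! ### Bounds for the tangle power -/

namespace CoverModel
open LoopGraph
variable {V E : Type*} {B : LoopGraph V E}

theorem exists_mem_fullCycleInvAtoms_occurs [Finite E] {M : CoverModel B}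
    (hM : ∀ n : M.degrees, B.fullCycleInvAtoms n ⊆ (M.law n).support) {v : V} {m : ℕ}
    (hv : m ≤ (B.selfLoopsAt v).ncard) : M.Occurs (dipole m) := by
  obtain ⟨c, hc, hc'⟩ := B.exists_representative
  obtain ⟨l, ht, hh, hcl, hl⟩ := B.exists_selfLoop_family hc hc' hv
  -- Degree at least two makes `0` and the last point distinct, which also separates the two lifts
  -- of a half-loop.
  refine ⟨B.dipoleHom v l ht hh, 2, ?_⟩
  rintro ⟨n, hn⟩ (h2 : 2 ≤ n)
  obtain ⟨k, rfl⟩ : ∃ k, n = k + 1 + 1 := ⟨n - 2, by omega⟩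
  obtain ⟨σ, hσ, hσ0⟩ := B.exists_fullCycleInvAtom_zero_last hc hc' (k + 1)
  refine ⟨σ, hM _ hσ, B.dipoleHomCover σ v l ht hh 0 (Fin.last _) fun k => hσ0 _ (hcl k),
    ?_, ?_, fun _ => rfl, ?_⟩
  · rintro (_ | _) (_ | _) h <;> simp_all [dipoleHomCover, Fin.ext_iff]
  · rintro ⟨i, _ | _⟩ ⟨j, _ | _⟩ h <;>
      simp_all [dipoleHomCover, Fin.ext_iff, hl.eq_iff, B.inv_injective.eq_iff]
  · rintro ⟨i, _ | _⟩ <;> rfl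

theorem occurs_dipole [Finite E] {M : CoverModel B} (hM : M.IsBasic ∨ M.EtaleOccurs) {v : V}
    {m : ℕ} (hv : m ≤ (B.selfLoopsAt v).ncard) : M.Occurs (dipole m) := by
  rcases hM with ⟨N, hN, rfl | rfl⟩ | hM
  · refine exists_mem_fullCycleInvAtoms_occurs (fun n σ hσ => ?_) hv
    simpa [permInvModel] using hσ.1
  · refine exists_mem_fullCycleInvAtoms_occurs (fun n σ hσ => ?_) hv
    simpa [fullCycleInvModel] using hσ
  · obtain ⟨c, hc, hc'⟩ := B.exists_representative
    obtain ⟨l, ht, hh, -, hl⟩ := B.exists_selfLoop_family hc hc' hv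
    refine ⟨B.dipoleHom v l ht hh, hM _ _ _ _ (B.isEtale_dipoleHom v l ht hh hl) fun e he => ?_⟩
    have := congrArg Prod.snd (show (dipole m).inv e = e from he)
    simp [dipole] at this

theorem le_tanglePower [Fintype E] {M : CoverModel B} (hM : M.NoWholeLoopOccurs) {m : ℕ}
    (hm : IsLeast {k : ℕ | √B.mu1 < (k : ℝ) - 1} m) :
    (((m : ℝ) - 2 : ℝ) : EReal) ≤ M.tanglePower := by
  refine le_sInf ?_
  rintro _ ⟨k, ⟨W, F, _, _, S, hconn, hocc, hmu, rfl⟩, rfl⟩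
  have hw : ∀ e, ¬ S.IsWholeLoop e := fun e he => hM W F S ⟨e, he⟩ hocc
  have h1 := hmu.trans_le (hconn.mu1_le_ord_add_one hw)
  have h0 := (hconn.norm_le_ord_add_one hw).1
  -- Minimality of `m` concerns natural numbers, so `ord + 2` is first recognised as one.
  obtain ⟨j, hj⟩ := Int.eq_ofNat_of_zero_le (show 0 ≤ S.ord + 2 by omega)
  have hj' : (S.ord : ℝ) + 2 = j := by exact_mod_cast hj
  have h2 : m ≤ j := hm.2 (show √B.mu1 < (j : ℝ) - 1 by linarith)
  have h3 : (m : ℝ) ≤ j := by exact_mod_cast h2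
  exact EReal.coe_le_coe_iff.2 (by linarith)

theorem tanglePower_eq_of_occurs_dipole [Fintype E] {M : CoverModel B}
    (hM : M.NoWholeLoopOccurs) {m : ℕ} (hm : IsLeast {k : ℕ | √B.mu1 < (k : ℝ) - 1} m)
    (h : M.Occurs (dipole m)) : M.tanglePower = (((m : ℝ) - 2 : ℝ) : EReal) := by
  refine le_antisymm (sInf_le ?_) (le_tanglePower hM hm)
  have h1 : √B.mu1 < (m : ℝ) - 1 := hm.1
  have hm1 : 1 ≤ m := by
    have : (1 : ℝ) < m := by linarith [Real.sqrt_nonneg B.mu1]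
    exact_mod_cast this.le
  refine ⟨(m : ℤ) - 2, ⟨Bool, Fin m × Bool, inferInstance, inferInstance, dipole m,
    isConnected_dipole hm1, h, ?_, ord_dipole m⟩, by simp⟩
  rwa [mu1_dipole hm1]

end CoverModel

/-! ### Full cycle models and regular base graphs -/

namespace LoopGraph
variable {V E : Type*} (B : LoopGraph V E)

/-- A whole-loop in a cover lies over a self-loop `a` whose permutation fixes a point `i`. If `a`
were a half-loop, `(a, i)` would be one too; so `a` is a whole-loop, and its full cycle has a fixed
point. -/
theorem noWholeLoopOccurs_fullCycleInvModel [Finite E] (N : Set ℕ) (hN : B.BasicDegrees N) :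
    (B.fullCycleInvModel N hN).NoWholeLoopOccurs := by
  rintro W F _ _ S ⟨e, hinv, hloop⟩ ⟨π, n₀, hn₀⟩
  -- Exceeding `n₀ + 1` also forces `n ≥ 2`; the only cycle of length one does fix its point.
  obtain ⟨n, hn, hlt⟩ := hN.infinite.exists_gt (n₀ + 1)
  obtain ⟨σ, hσ, f, -, hf, -, -⟩ := hn₀ ⟨n, hn⟩ (show n₀ ≤ n by omega)
  replace hσ : σ ∈ B.fullCycleInvAtoms n := by simpa [fullCycleInvModel] using hσ
  have h1 := f.head_onE e
  rw [hloop, ← f.tail_onE e] at h1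
  have h2 := f.inv_onE e
  have h3 : (B.cover σ).inv (f.onE e) ≠ f.onE e := fun h => hinv (hf (h2.symm.trans h))
  rcases hfe : f.onE e with ⟨a, i⟩
  rw [hfe] at h1 h3
  simp only [cover, Prod.mk.injEq, ne_eq, not_and] at h1 h3
  obtain ⟨k, hk⟩ : ∃ k : Fin n, k ≠ i := by
    have : Nontrivial (Fin n) := Fin.nontrivial_iff_two_le.2 (show 2 ≤ n by omega)
    exact exists_ne i
  refine hk ?_
  have h4 : B.IsWholeLoop a := ⟨fun h => h3 h h1.2, h1.1⟩
  obtain ⟨z, hz⟩ := hσ.2 a h4 i k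
  rw [← hz]
  exact Equiv.Perm.zpow_apply_eq_self_of_apply_eq_self h1.2 z

theorem isLeast_of_isRegular [Fintype E] [Nonempty V] {d : ℕ} (hd : 1 ≤ d)
    (hB : B.IsRegular d) :
    IsLeast {k : ℕ | √B.mu1 < (k : ℝ) - 1} (⌊√((d : ℝ) - 1)⌋₊ + 2) := by
  rw [B.mu1_of_isRegular hd hB]
  constructor
  · have := Nat.lt_floor_add_one √((d : ℝ) - 1)
    simp only [Set.mem_ofPred_eq]
    push_cast
    linarith
  · intro k (hk : √((d : ℝ) - 1) < (k : ℝ) - 1)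
    have h0 := Real.sqrt_nonneg ((d : ℝ) - 1)
    have h1 : 1 ≤ k := by
      have : (1 : ℝ) < k := by linarith
      exact_mod_cast this.le
    have h2 : ⌊√((d : ℝ) - 1)⌋₊ < k - 1 := (Nat.floor_lt h0).2 (by push_cast [h1]; exact hk)
    omega

end LoopGraph

theorem theorem7p2 {V E : Type*} [Fintype V] [Fintype E] (B : LoopGraph V E) :
    (∀ m : ℕ, IsLeast {k : ℕ | √B.mu1 < (k : ℝ) - 1} m →
      ∀ M : CoverModel B, M.NoWholeLoopOccurs →
        (((m : ℝ) - 2 : ℝ) : EReal) ≤ M.tanglePower ∧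
        (M.Occurs (LoopGraph.dipole m) → M.tanglePower = (((m : ℝ) - 2 : ℝ) : EReal)) ∧
        ((M.IsBasic ∨ M.EtaleOccurs) → (∃ v, m + 1 ≤ (B.selfLoopsAt v).ncard) →
          M.tanglePower = (((m : ℝ) - 2 : ℝ) : EReal))) ∧
    (∀ (N : Set ℕ) (hN : B.BasicDegrees N),
      (B.fullCycleInvModel N hN).NoWholeLoopOccurs ∧
      ∀ d : ℕ, Nonempty V → 1 ≤ d → B.IsRegular d →
        IsLeast {k : ℕ | √B.mu1 < (k : ℝ) - 1} (⌊√((d : ℝ) - 1)⌋₊ + 2) ∧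
        (((⌊√((d : ℝ) - 1)⌋₊ : ℕ) : ℝ) : EReal) ≤ (B.fullCycleInvModel N hN).tanglePower) := by
  refine ⟨fun m hm M hM => ⟨CoverModel.le_tanglePower hM hm,
    CoverModel.tanglePower_eq_of_occurs_dipole hM hm, fun hM' ⟨v, hv⟩ =>
      CoverModel.tanglePower_eq_of_occurs_dipole hM hm
        (CoverModel.occurs_dipole hM' ((Nat.le_succ m).trans hv))⟩,
    fun N hN => ⟨B.noWholeLoopOccurs_fullCycleInvModel N hN, fun d _ hd hB => ?_⟩⟩
  have hm := B.isLeast_of_isRegular hd hB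
  refine ⟨hm, ?_⟩
  have h := CoverModel.le_tanglePower (B.noWholeLoopOccurs_fullCycleInvModel N hN) hm
  rwa [Nat.cast_add, Nat.cast_ofNat, add_sub_cancel_right] at h
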